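/- Let $A \in \mathbb{R}^{n\times n}$, $B \in \mathbb{R}^{n\times m}$, let $Q \in \mathbb{R}^{n\times n}$ be symmetric, and for symmetric $K\in\mathbb{R}^{n\times n}$ put $\phi(K) := A^{\top}K + KA + Q - KBB^{\top}K$. For symmetric matrices, $P \le P'$ means that $P'-P$ is positive semidefinite. Suppose that $(A,B)$ is stabilizable (that is, for some $F\in\mathbb{R}^{m\times n}$ all eigenvalues of $A+BF$ have negative real part) and that there is a symmetric $K \le 0$ with $\phi(K) \ge 0$. Let $\mathcal{C} = \operatorname{im} B + A \operatorname{im} B + \dots + A^{n-1}\operatorname{im} B$ be the controllable subspace, of dimension $n_1$, let $\mathcal{X}_2$ be any complement of it, so that $\mathbb{R}^n = \mathcal{C}\oplus\mathcal{X}_2$, and let $T$ be an invertible matrix whose first $n_1$ columns form a basis of $\mathcal{C}$ and whose remaining columns form a basis of $\mathcal{X}_2$. Write, with first blocks of size $n_1$, $$T^{-1}AT = \begin{bmatrix} A_1 & A_{12} \\ 0 & A_2 \end{bmatrix},\qquad T^{-1}B = \begin{bmatrix} B_1 \\ 0\end{bmatrix},\qquad T^{\top}QT = \begin{bmatrix}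 Q_1 & Q_{12} \\ Q_{12}^{\top} & Q_2 \end{bmatrix}.$$ Then the set $$\partial\Gamma_1 := \{K_1 \in \mathbb{R}^{n_1\times n_1} \mid K_1 = K_1^{\top},\ A_1^{\top}K_1 + K_1A_1 + Q_1 - K_1B_1B_1^{\top}K_1 = 0\}$$ has a minimal element $K_1^-$, that is, $K_1^-\in\partial\Gamma_1$ and $K_1^- \le K_1$ for all $K_1\in\partial\Gamma_1$; moreover $K_1^- \le 0$. -/

import Mathlib

/-! Symmetric real matrices are ordered by `P ≤ Q ↔ (Q - P).PosSemidef` (the Loewner order,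
Mathlib's scoped instance in `MatrixOrder`). -/
open scoped MatrixOrder

namespace RiccatiLQ

/-- `(A, B)` is stabilizable: some state feedback `u = F x` makes `A + B F` Hurwitz, i.e. all
complex eigenvalues of `A + B F` have negative real part. -/
def Stabilizable {n m : ℕ} (A : Matrix (Fin n) (Fin n) ℝ) (B : Matrix (Fin n) (Fin m) ℝ) : Prop :=
  ∃ F : Matrix (Fin m) (Fin n) ℝ,
    ∀ z ∈ spectrum ℂ ((A + B * F).map (algebraMap ℝ ℂ)), z.re < 0

/-- The controllable subspace `⟨A | im B⟩ = im B + A (im B) + ⋯ + A ^ (n - 1) (im B)`. -/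
def controllableSubspace {n m : ℕ} (A : Matrix (Fin n) (Fin n) ℝ) (B : Matrix (Fin n) (Fin m) ℝ) :
    Submodule ℝ (Fin n → ℝ) :=
  ⨆ k : Fin n, (LinearMap.range B.mulVecLin).map (A ^ (k : ℕ)).mulVecLin

/-- The Riccati map `φ(K) = Aᵀ K + K A + Q - K B Bᵀ K`. -/
def riccati {n m : ℕ} (A : Matrix (Fin n) (Fin n) ℝ) (B : Matrix (Fin n) (Fin m) ℝ)
    (Q K : Matrix (Fin n) (Fin n) ℝ) : Matrix (Fin n) (Fin n) ℝ :=
  A.transpose * K + K * A + Q - K * B * B.transpose * K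

/-- `Γ`: the symmetric solutions of the algebraic Riccati inequality `φ(K) ≥ 0`. -/
def ariSol {n m : ℕ} (A : Matrix (Fin n) (Fin n) ℝ) (B : Matrix (Fin n) (Fin m) ℝ)
    (Q : Matrix (Fin n) (Fin n) ℝ) : Set (Matrix (Fin n) (Fin n) ℝ) :=
  {K | K.IsSymm ∧ 0 ≤ riccati A B Q K}

/-- `Γ₋`: the negative semidefinite solutions of the algebraic Riccati inequality. -/
def ariSolNeg {n m : ℕ} (A : Matrix (Fin n) (Fin n) ℝ) (B : Matrix (Fin n) (Fin m) ℝ)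
    (Q : Matrix (Fin n) (Fin n) ℝ) : Set (Matrix (Fin n) (Fin n) ℝ) :=
  {K | K ∈ ariSol A B Q ∧ K ≤ 0}

/-- `∂Γ`: the symmetric solutions of the algebraic Riccati equation `φ(K) = 0`. -/
def areSol {n m : ℕ} (A : Matrix (Fin n) (Fin n) ℝ) (B : Matrix (Fin n) (Fin m) ℝ)
    (Q : Matrix (Fin n) (Fin n) ℝ) : Set (Matrix (Fin n) (Fin n) ℝ) :=
  {K | K.IsSymm ∧ riccati A B Q K = 0}

/-- `∂Γ₋`: the negative semidefinite solutions of the algebraic Riccati equation. -/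
def areSolNeg {n m : ℕ} (A : Matrix (Fin n) (Fin n) ℝ) (B : Matrix (Fin n) (Fin m) ℝ)
    (Q : Matrix (Fin n) (Fin n) ℝ) : Set (Matrix (Fin n) (Fin n) ℝ) :=
  {K | K ∈ areSol A B Q ∧ K ≤ 0}

section Coordinates

/-- The matrix `T` whose columns are the vectors of the basis `b` of `ℝⁿ`. -/
noncomputable def basisMatrix {n n₁ n₂ : ℕ} (b : Module.Basis (Fin n₁ ⊕ Fin n₂) ℝ (Fin n → ℝ)) :
    Matrix (Fin n) (Fin n₁ ⊕ Fin n₂) ℝ :=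
  (Pi.basisFun ℝ (Fin n)).toMatrix b

/-- The inverse `T⁻¹` of `basisMatrix b`: it sends `x` to its coordinates in the basis `b`. -/
noncomputable def basisMatrixInv {n n₁ n₂ : ℕ} (b : Module.Basis (Fin n₁ ⊕ Fin n₂) ℝ (Fin n → ℝ)) :
    Matrix (Fin n₁ ⊕ Fin n₂) (Fin n) ℝ :=
  b.toMatrix (Pi.basisFun ℝ (Fin n))

theorem basisMatrixInv_mul {n n₁ n₂ : ℕ} (b : Module.Basis (Fin n₁ ⊕ Fin n₂) ℝ (Fin n → ℝ)) :
    basisMatrixInv b * basisMatrix b = 1 :=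
  b.toMatrix_mul_toMatrix_flip _

theorem basisMatrix_mul_inv {n n₁ n₂ : ℕ} (b : Module.Basis (Fin n₁ ⊕ Fin n₂) ℝ (Fin n → ℝ)) :
    basisMatrix b * basisMatrixInv b = 1 :=
  (Pi.basisFun ℝ (Fin n)).toMatrix_mul_toMatrix_flip _

/-- `A₁`: the upper left block of `T⁻¹ A T`. -/
noncomputable def blockA {n n₁ n₂ : ℕ} (b : Module.Basis (Fin n₁ ⊕ Fin n₂) ℝ (Fin n → ℝ))
    (A : Matrix (Fin n) (Fin n) ℝ) : Matrix (Fin n₁) (Fin n₁) ℝ :=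
  (basisMatrixInv b * A * basisMatrix b).toBlocks₁₁

/-- `B₁`: the upper block of `T⁻¹ B`. -/
noncomputable def blockB {n m n₁ n₂ : ℕ} (b : Module.Basis (Fin n₁ ⊕ Fin n₂) ℝ (Fin n → ℝ))
    (B : Matrix (Fin n) (Fin m) ℝ) : Matrix (Fin n₁) (Fin m) ℝ :=
  (basisMatrixInv b * B).toRows₁

/-- `Q₁`: the upper left block of `Tᵀ Q T`, the matrix of the form `xᵀ Q x` in the basis `b`. -/
noncomputable def blockQ {n n₁ n₂ : ℕ} (b : Module.Basis (Fin n₁ ⊕ Fin n₂) ℝ (Fin n → ℝ))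
    (Q : Matrix (Fin n) (Fin n) ℝ) : Matrix (Fin n₁) (Fin n₁) ℝ :=
  ((basisMatrix b).transpose * Q * basisMatrix b).toBlocks₁₁

end Coordinates

end RiccatiLQ

namespace RiccatiLQ

open Matrix Filter Topology

/-! Let `V` be the first `n₁` columns of `T`. The controllable subspace is `A`-invariant and
contains `im B`, so `A V = V A₁` and `B = V B₁`. Hence `K ↦ Vᵀ K V` intertwines the Riccati maps
(`riccati_block`), and the given `K ≤ 0` yields a solution `Vᵀ K V ≤ 0` of the reduced inequality. A
least solution of the reduced equation that lies below all solutions of the inequality is therefore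
`≤ 0`.

Such a solution exists because `(A₁, B₁)` is controllable (`block_controllable`). Then `(-A₁, B₁)`
is stabilizable by Bass' feedback, and negation turns its greatest Riccati solution into the least
one for `(A₁, B₁)` (`exists_least_areSol`). The greatest solution is the limit of the
Newton-Kleinman iteration: Lyapunov equations give a decreasing sequence bounded below by every
solution of the inequality (`exists_greatest_areSol`). -/

theorem tendsto_pow_zero_of_spectrum {R : Type*} [NormedRing R] [NormedAlgebra ℂ R]
    [CompleteSpace R] [Nontrivial R] (a : R) (h : ∀ z ∈ spectrum ℂ a, ‖z‖ < 1) :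
    Tendsto (fun k : ℕ => a ^ k) atTop (𝓝 0) := by
  have h1 : spectralRadius ℂ a < (1 : NNReal) :=
    spectrum.spectralRadius_lt_of_forall_lt a fun z hz => by exact_mod_cast h z hz
  obtain ⟨r, hr, hr1⟩ := ENNReal.lt_iff_exists_nnreal_btwn.1 h1
  have hr1' : r < 1 := by exact_mod_cast hr1
  -- Gelfand's formula: eventually `‖a ^ k‖ < r ^ k` with `r < 1`.
  have hev := (spectrum.pow_nnnorm_pow_one_div_tendsto_nhds_spectralRadius a).eventually
    (gt_mem_nhds hr)
  rw [tendsto_zero_iff_norm_tendsto_zero]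
  refine squeeze_zero' (Eventually.of_forall fun _ => norm_nonneg _) ?_
    (tendsto_pow_atTop_nhds_zero_of_lt_one r.2 (show (r : ℝ) < 1 from hr1'))
  filter_upwards [hev, eventually_gt_atTop 0] with k hk hk0
  have hk0' : (0 : ℝ) < k := by exact_mod_cast hk0
  have h2 := ENNReal.rpow_le_rpow hk.le hk0'.le
  rw [← ENNReal.rpow_mul, one_div, inv_mul_cancel₀ hk0'.ne', ENNReal.rpow_one,
    ENNReal.rpow_natCast] at h2
  exact_mod_cast h2

/-! ### Hurwitz matrices, Lyapunov equations and stabilization. -/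

section Matrix

variable {ι κ : Type*} [Fintype ι] [DecidableEq ι] [Fintype κ]

theorem exists_eigenvector_of_mem_spectrum {M : Matrix ι ι ℂ} {z : ℂ} (hz : z ∈ spectrum ℂ M) :
    ∃ x : ι → ℂ, x ≠ 0 ∧ M *ᵥ x = z • x := by
  rw [← Matrix.spectrum_toLin', ← Module.End.hasEigenvalue_iff_mem_spectrum] at hz
  obtain ⟨x, hx⟩ := hz.exists_hasEigenvector
  exact ⟨x, hx.2, by simpa using hx.apply_eq_smul⟩

theorem mem_spectrum_of_eigenvector {M : Matrix ι ι ℂ} {z : ℂ} {x : ι → ℂ} (hx : x ≠ 0)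
    (h : M *ᵥ x = z • x) : z ∈ spectrum ℂ M := by
  rw [← Matrix.spectrum_toLin', ← Module.End.hasEigenvalue_iff_mem_spectrum]
  exact Module.End.hasEigenvalue_of_hasEigenvector
    ⟨Module.End.mem_eigenspace_iff.2 (by simpa using h), hx⟩

open scoped Matrix.Norms.Operator in
theorem tendsto_matrix_pow_zero {M : Matrix ι ι ℂ} (h : ∀ z ∈ spectrum ℂ M, ‖z‖ < 1) :
    Tendsto (fun k : ℕ => M ^ k) atTop (𝓝 0) := by
  cases isEmpty_or_nonempty ι
  · have : (fun k : ℕ => M ^ k) = fun _ => 0 := by ext k i; exact isEmptyElim i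
    rw [this]; exact tendsto_const_nhds
  · exact tendsto_pow_zero_of_spectrum M h

open scoped Matrix.Norms.Operator in
theorem exists_bound_eigenvalues (M : Matrix ι ι ℂ) :
    ∃ c : ℝ, 0 < c ∧ ∀ z : ℂ, ∀ x : ι → ℂ, x ≠ 0 → M *ᵥ x = z • x → ‖z‖ < c := by
  refine ⟨‖M‖ * ‖(1 : Matrix ι ι ℂ)‖ + 1, by positivity, fun z x hx h => ?_⟩
  have := spectrum.norm_le_norm_mul_of_mem (mem_spectrum_of_eigenvector hx h)
  linarith

/-- Every complex eigenvalue of the real matrix `A` has negative real part. -/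
def IsHurwitz (A : Matrix ι ι ℝ) : Prop :=
  ∀ (z : ℂ) (x : ι → ℂ), x ≠ 0 → A.map (algebraMap ℝ ℂ) *ᵥ x = z • x → z.re < 0

omit [DecidableEq ι] in
theorem re_map_mulVec (A : Matrix ι ι ℝ) (x : ι → ℂ) :
    (fun i => (A.map (algebraMap ℝ ℂ) *ᵥ x) i |>.re) = A *ᵥ fun i => (x i).re := by
  ext i
  simp [Matrix.mulVec, dotProduct]

omit [DecidableEq ι] in
theorem im_map_mulVec (A : Matrix ι ι ℝ) (x : ι → ℂ) :
    (fun i => (A.map (algebraMap ℝ ℂ) *ᵥ x) i |>.im) = A *ᵥ fun i => (x i).im := by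
  ext i
  simp [Matrix.mulVec, dotProduct]

omit [DecidableEq ι] in
-- Lets later eigenvalue arguments run on real pairs `u + i v` and real quadratic forms.
theorem map_mulVec_ofReal_eq_iff (A : Matrix ι ι ℝ) (x : ι → ℂ) (z : ℂ) :
    A.map (algebraMap ℝ ℂ) *ᵥ x = z • x ↔
      A *ᵥ (fun i => (x i).re) = z.re • (fun i => (x i).re) - z.im • (fun i => (x i).im) ∧
      A *ᵥ (fun i => (x i).im) = z.im • (fun i => (x i).re) + z.re • (fun i => (x i).im) := by
  rw [← re_map_mulVec, ← im_map_mulVec]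
  simp only [funext_iff, Complex.ext_iff, forall_and, Pi.smul_apply, smul_eq_mul, Complex.mul_re,
    Complex.mul_im, Pi.sub_apply, Pi.add_apply]
  constructor <;> rintro ⟨h1, h2⟩ <;> refine ⟨h1, fun i => ?_⟩ <;> rw [h2] <;> ring

omit [DecidableEq ι] in
theorem IsHurwitz.real_pair {A : Matrix ι ι ℝ} (hA : IsHurwitz A) {a b : ℝ} {u v : ι → ℝ}
    (hu : A *ᵥ u = a • u - b • v) (hv : A *ᵥ v = b • u + a • v) (h : u ≠ 0 ∨ v ≠ 0) : a < 0 := by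
  refine hA ⟨a, b⟩ (fun i => ⟨u i, v i⟩) (fun h0 => ?_)
    ((map_mulVec_ofReal_eq_iff _ _ _).2 ⟨hu, hv⟩)
  rcases h with h | h
  · exact h (funext fun i => by simpa using congrArg Complex.re (congrFun h0 i))
  · exact h (funext fun i => by simpa using congrArg Complex.im (congrFun h0 i))

omit [DecidableEq ι] in
theorem isHurwitz_of_real_pair {A : Matrix ι ι ℝ}
    (h : ∀ (a b : ℝ) (u v : ι → ℝ), A *ᵥ u = a • u - b • v → A *ᵥ v = b • u + a • v →
      u ≠ 0 ∨ v ≠ 0 → a < 0) : IsHurwitz A := by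
  intro z x hx hz
  obtain ⟨h1, h2⟩ := (map_mulVec_ofReal_eq_iff _ _ _).1 hz
  refine h _ _ _ _ h1 h2 ?_
  by_contra! h0
  exact hx (funext fun i => Complex.ext (congrFun h0.1 i) (congrFun h0.2 i))

theorem exists_isHurwitz_neg_add (A : Matrix ι ι ℝ) :
    ∃ β : ℝ, 0 < β ∧ IsHurwitz (-(A + β • (1 : Matrix ι ι ℝ))) := by
  obtain ⟨c, hc, h⟩ := exists_bound_eigenvalues (A.map (algebraMap ℝ ℂ))
  refine ⟨c, hc, isHurwitz_of_real_pair fun a b u v hu hv huv => ?_⟩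
  -- An eigenvalue `a + i b` of `-(A + c)` comes from the eigenvalue `-a - c - i b` of `A`, whose
  -- modulus is below `c`.
  have key := h ⟨-a - c, -b⟩ (fun i => ⟨u i, v i⟩) (fun h0 => ?_)
    ((map_mulVec_ofReal_eq_iff _ _ _).2 ⟨?_, ?_⟩)
  · have := (Complex.abs_re_le_norm _).trans_lt key
    have := (abs_lt.1 this).1
    simp only at this
    linarith
  · rcases huv with h | h
    · exact h (funext fun i => by simpa using congrArg Complex.re (congrFun h0 i))
    · exact h (funext fun i => by simpa using congrArg Complex.im (congrFun h0 i))
  · simp only [neg_mulVec, add_mulVec, smul_mulVec, one_mulVec] at hu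
    ext i
    have := congrFun hu i
    simp at this ⊢
    linarith
  · simp only [neg_mulVec, add_mulVec, smul_mulVec, one_mulVec] at hv
    ext i
    have := congrFun hv i
    simp at this ⊢
    linarith

/-! ### The Cayley transform and the Lyapunov equation -/

theorem IsHurwitz.isUnit_one_sub {A : Matrix ι ι ℝ} (hA : IsHurwitz A) : IsUnit (1 - A).det := by
  rw [isUnit_iff_ne_zero]
  intro h0
  obtain ⟨v, hv, h⟩ := Matrix.exists_mulVec_eq_zero_iff.2 h0
  rw [sub_mulVec, one_mulVec, sub_eq_zero] at h
  have := hA.real_pair (a := 1) (b := 0) (u := v) (v := 0) (by simp [← h]) (by simp) (Or.inl hv)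
  linarith

/-- The Cayley transform carries the open left half-plane into the open unit disc, so the powers
decay without any matrix exponential. -/
theorem IsHurwitz.tendsto_cayley_pow {A : Matrix ι ι ℝ} (hA : IsHurwitz A) :
    Tendsto (fun k : ℕ => ((1 + A) * (1 - A)⁻¹) ^ k) atTop (𝓝 0) := by
  set C := (1 + A) * (1 - A)⁻¹ with hC
  have hCA : C * (1 - A) = 1 + A := by
    rw [hC, Matrix.mul_assoc, nonsing_inv_mul _ hA.isUnit_one_sub, Matrix.mul_one]
  set φ : Matrix ι ι ℝ →+* Matrix ι ι ℂ := (algebraMap ℝ ℂ).mapMatrix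
  have hsp : ∀ z ∈ spectrum ℂ (φ C), ‖z‖ < 1 := by
    intro z hz
    obtain ⟨x, hx, hzx⟩ := exists_eigenvector_of_mem_spectrum hz
    set y := φ (1 - A)⁻¹ *ᵥ x with hy
    have hxy : x = φ (1 - A) *ᵥ y := by
      rw [hy, mulVec_mulVec, ← map_mul, mul_nonsing_inv _ hA.isUnit_one_sub, map_one, one_mulVec]
    have hy0 : y ≠ 0 := by rintro h; rw [h, mulVec_zero] at hxy; exact hx hxy
    have h1 : φ (1 + A) *ᵥ y = z • (φ (1 - A) *ᵥ y) := by
      rw [← hxy, ← hzx, ← hCA, map_mul, ← mulVec_mulVec, ← hxy]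
    simp only [map_add, map_sub, map_one, add_mulVec, sub_mulVec, one_mulVec] at h1
    have h2 : (z + 1) • (φ A *ᵥ y) = (z - 1) • y := by
      ext i
      have := congrFun h1 i
      simp only [Pi.add_apply, Pi.smul_apply, Pi.sub_apply, smul_eq_mul] at this ⊢
      linear_combination this
    have hz1 : z + 1 ≠ 0 := by
      intro h
      rw [h, zero_smul] at h2
      rcases smul_eq_zero.1 h2.symm with h3 | h3
      · have : (2 : ℂ) = 0 := by linear_combination h - h3
        norm_num at this
      · exact hy0 h3
    have h3 : φ A *ᵥ y = ((z - 1) / (z + 1)) • y := by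
      rw [div_eq_inv_mul, mul_smul, ← h2, smul_smul, inv_mul_cancel₀ hz1, one_smul]
    have h4 := hA _ y hy0 h3
    rw [Complex.div_re, ← add_div, div_lt_iff₀ (Complex.normSq_pos.2 hz1), zero_mul] at h4
    simp at h4
    have h5 : ‖z‖ ^ 2 < 1 := by rw [← Complex.normSq_eq_norm_sq, Complex.normSq_apply]; nlinarith
    nlinarith [norm_nonneg z]
  have h := tendsto_matrix_pow_zero hsp
  have hre := (Continuous.tendsto (by fun_prop) 0 :
    Tendsto (fun M : Matrix ι ι ℂ => M.map Complex.re) (𝓝 0) _).comp h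
  rw [show (0 : Matrix ι ι ℂ).map Complex.re = 0 by ext; simp] at hre
  refine hre.congr fun k => ?_
  rw [Function.comp_apply, ← map_pow]
  ext i j
  simp [φ]

omit [DecidableEq ι] in
theorem posSemidef_of_tendsto {X : ℕ → Matrix ι ι ℝ} {Y : Matrix ι ι ℝ}
    (hX : ∀ k, (X k).PosSemidef) (h : Tendsto X atTop (𝓝 Y)) : Y.PosSemidef := by
  refine PosSemidef.of_dotProduct_mulVec_nonneg ?_ fun x => ?_
  · exact tendsto_nhds_unique ((Continuous.tendsto (by fun_prop) Y :
      Tendsto (fun M : Matrix ι ι ℝ => Mᴴ) (𝓝 Y) (𝓝 Yᴴ)).comp h)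
      (h.congr fun k => ((hX k).1).symm)
  · exact ge_of_tendsto' ((Continuous.tendsto (by fun_prop) Y :
      Tendsto (fun M : Matrix ι ι ℝ => star x ⬝ᵥ (M *ᵥ x)) (𝓝 Y) _).comp h)
      fun k => (hX k).dotProduct_mulVec_nonneg x

/-- Lyapunov's theorem. -/
theorem IsHurwitz.posSemidef_of_lyapunov {A X : Matrix ι ι ℝ} (hA : IsHurwitz A)
    (h : (-(Aᵀ * X + X * A)).PosSemidef) : X.PosSemidef := by
  set C := (1 + A) * (1 - A)⁻¹ with hC
  set N := (1 - A)⁻¹ with hN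
  have hN1 : (1 - A) * N = 1 := mul_nonsing_inv _ hA.isUnit_one_sub
  have hN2 : Nᵀ * (1 - Aᵀ) = 1 := by
    have := congrArg transpose hN1
    rwa [transpose_mul, transpose_sub, transpose_one] at this
  -- The Lyapunov inequality becomes the Stein inequality `Cᵀ X C ≤ X`; iterating it and letting `C
  -- ^ k → 0` gives `0 ≤ X`.
  have h1 : (X - Cᵀ * X * C).PosSemidef := by
    have h2 : X - Cᵀ * X * C = Nᵀ * ((2 : ℝ) • -(Aᵀ * X + X * A)) * N := by
      have e : (2 : ℝ) • -(Aᵀ * X + X * A) =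
        (1 - Aᵀ) * X * (1 - A) - (1 + Aᵀ) * X * (1 + A) := by
        rw [two_smul]; noncomm_ring
      rw [e, hC, transpose_mul, transpose_add, transpose_one]
      calc X - Nᵀ * (1 + Aᵀ) * X * ((1 + A) * N)
          = (Nᵀ * (1 - Aᵀ)) * X * ((1 - A) * N) - Nᵀ * (1 + Aᵀ) * X * ((1 + A) * N) := by
            rw [hN1, hN2, Matrix.one_mul, Matrix.mul_one]
        _ = _ := by noncomm_ring
    rw [h2]
    have := (h.smul (zero_le_two (α := ℝ))).conjTranspose_mul_mul_same N
    rwa [conjTranspose_eq_transpose_of_trivial] at this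
  have h2 : ∀ k : ℕ, (X - (C ^ k)ᵀ * X * C ^ k).PosSemidef := by
    intro k
    induction k with
    | zero => simpa using PosSemidef.zero
    | succ k ih =>
      have h3 := (h1.conjTranspose_mul_mul_same (C ^ k)).add ih
      rw [conjTranspose_eq_transpose_of_trivial] at h3
      convert h3 using 1
      rw [pow_succ', transpose_mul]
      noncomm_ring
  refine posSemidef_of_tendsto h2 ?_
  have h3 : Tendsto (fun k : ℕ => C ^ k) atTop (𝓝 0) := hA.tendsto_cayley_pow
  have h4 := (Continuous.tendsto (by fun_prop) 0 :
      Tendsto (fun M : Matrix ι ι ℝ => X - Mᵀ * X * M) (𝓝 0) _).comp h3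
  rw [transpose_zero, Matrix.zero_mul, Matrix.zero_mul, sub_zero] at h4
  exact h4

/-- Lyapunov's theorem for `X` and `-X` makes the operator injective, hence surjective in finite
dimension. -/
theorem IsHurwitz.exists_lyapunov {A : Matrix ι ι ℝ} (hA : IsHurwitz A) (M : Matrix ι ι ℝ) :
    ∃ X : Matrix ι ι ℝ, Aᵀ * X + X * A = M := by
  let f : Matrix ι ι ℝ →ₗ[ℝ] Matrix ι ι ℝ :=
    LinearMap.mulLeft ℝ Aᵀ + LinearMap.mulRight ℝ A
  have hf : Function.Injective f := by
    rw [← LinearMap.ker_eq_bot, LinearMap.ker_eq_bot']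
    intro X hX
    have hX' : Aᵀ * X + X * A = 0 := hX
    have h1 := hA.posSemidef_of_lyapunov (X := X) (by rw [hX', neg_zero]; exact .zero)
    have h2 := hA.posSemidef_of_lyapunov (X := -X)
      (by rw [Matrix.mul_neg, Matrix.neg_mul, ← neg_add, hX', neg_zero, neg_zero]; exact .zero)
    exact le_antisymm (neg_nonneg.1 h2.nonneg) h1.nonneg
  exact LinearMap.injective_iff_surjective.1 hf M

omit [DecidableEq ι] in
theorem dotProduct_lyapunov {A X : Matrix ι ι ℝ} (hX : X.IsSymm) {a b : ℝ} {u v : ι → ℝ}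
    (hu : A *ᵥ u = a • u - b • v) (hv : A *ᵥ v = b • u + a • v) :
    u ⬝ᵥ (Aᵀ * X + X * A) *ᵥ u + v ⬝ᵥ (Aᵀ * X + X * A) *ᵥ v =
      2 * a * (u ⬝ᵥ X *ᵥ u + v ⬝ᵥ X *ᵥ v) := by
  have key : ∀ w w' : ι → ℝ, w ⬝ᵥ X *ᵥ w' = w' ⬝ᵥ X *ᵥ w := fun w w' => by
    rw [dotProduct_mulVec, ← mulVec_transpose, hX.eq, dotProduct_comm]
  simp only [add_mulVec, ← mulVec_mulVec, dotProduct_add, dotProduct_mulVec _ Aᵀ, vecMul_transpose,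
    hu, hv]
  simp only [mulVec_add, mulVec_sub, mulVec_smul, dotProduct_add, dotProduct_sub, dotProduct_smul,
    add_dotProduct, sub_dotProduct, smul_dotProduct, smul_eq_mul, key v u]
  ring

omit [DecidableEq ι] in
/-- If `X` is a positive semidefinite solution of `Aᵀ X + X A + Dᵀ D ≤ 0` and `D` detects all
unstable modes of `A`, then `A` is Hurwitz. -/
theorem isHurwitz_of_lyapunov {A X : Matrix ι ι ℝ} {D : Matrix κ ι ℝ} (hX : X.PosSemidef)
    (h : (-(Aᵀ * X + X * A) - Dᵀ * D).PosSemidef)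
    (hD : ∀ (a b : ℝ) (u v : ι → ℝ), A *ᵥ u = a • u - b • v → A *ᵥ v = b • u + a • v →
      u ≠ 0 ∨ v ≠ 0 → D *ᵥ u = 0 → D *ᵥ v = 0 → a < 0) : IsHurwitz A := by
  refine isHurwitz_of_real_pair fun a b u v hu hv huv => ?_
  -- If `0 ≤ a`, the quadratic forms at `u` and `v` force `D u = D v = 0`, and detectability gives
  -- `a < 0`.
  by_contra! ha
  have hXs : X.IsSymm := by simpa using hX.1
  have h1 := dotProduct_lyapunov hXs hu hv
  have h2 := h.dotProduct_mulVec_nonneg u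
  have h3 := h.dotProduct_mulVec_nonneg v
  have h4 := hX.dotProduct_mulVec_nonneg u
  have h5 := hX.dotProduct_mulVec_nonneg v
  simp only [star_trivial, sub_mulVec, neg_mulVec, dotProduct_sub, dotProduct_neg] at h2 h3 h4 h5
  have hDD : ∀ w : ι → ℝ, w ⬝ᵥ (Dᵀ * D) *ᵥ w = (D *ᵥ w) ⬝ᵥ (D *ᵥ w) := fun w => by
    rw [← mulVec_mulVec, dotProduct_mulVec, vecMul_transpose]
  rw [hDD] at h2 h3
  have h6 : 0 ≤ 2 * a * (u ⬝ᵥ X *ᵥ u + v ⬝ᵥ X *ᵥ v) := by positivity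
  have h7 : 0 ≤ (D *ᵥ u) ⬝ᵥ (D *ᵥ u) := by simpa using dotProduct_star_self_nonneg (D *ᵥ u)
  have h8 : 0 ≤ (D *ᵥ v) ⬝ᵥ (D *ᵥ v) := by simpa using dotProduct_star_self_nonneg (D *ᵥ v)
  have := hD a b u v hu hv huv (dotProduct_self_eq_zero.1 (by linarith))
    (dotProduct_self_eq_zero.1 (by linarith))
  linarith

/-- Bass' stabilization: a controllable pair is stabilizable. -/
theorem exists_isHurwitz_of_controllable {A : Matrix ι ι ℝ} {B : Matrix ι κ ℝ}
    (h : ∀ y : ι → ℝ, (∀ k : ℕ, Bᵀ *ᵥ ((Aᵀ ^ k) *ᵥ y) = 0) → y = 0) :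
    ∃ F : Matrix κ ι ℝ, IsHurwitz (A - B * F) := by
  obtain ⟨β, hβ, hH⟩ := exists_isHurwitz_neg_add Aᵀ
  -- `W` is a Gramian of the shifted pair. The factor 2 matches the two feedback terms in the
  -- closed-loop Lyapunov expression.
  obtain ⟨W, hW⟩ := hH.exists_lyapunov (-((2 : ℝ) • (B * Bᵀ)))
  have hBB : (B * Bᵀ).PosSemidef := by
    simpa using posSemidef_self_mul_conjTranspose B
  have hWp : W.PosSemidef := hH.posSemidef_of_lyapunov (by
    rw [hW, neg_neg]; exact hBB.smul zero_le_two)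
  have hWs : Wᵀ = W := by simpa using hWp.1.eq
  have hW' : A * W + W * Aᵀ + (2 * β) • W = (2 : ℝ) • (B * Bᵀ) := by
    rw [← neg_inj, ← hW]
    simp only [transpose_neg, transpose_add, transpose_transpose, transpose_smul, transpose_one]
    simp only [Matrix.neg_mul, Matrix.add_mul, Matrix.mul_neg, Matrix.mul_add, Matrix.smul_mul,
      Matrix.mul_smul, Matrix.one_mul, Matrix.mul_one, two_mul, add_smul]
    abel
  -- The kernel of `W` is `Aᵀ`-invariant and lies in `ker Bᵀ`, so controllability makes it trivial.
  have hker : ∀ y, W *ᵥ y = 0 → Bᵀ *ᵥ y = 0 ∧ W *ᵥ (Aᵀ *ᵥ y) = 0 := by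
    intro y hy
    have h1 := congrArg (· *ᵥ y) hW'
    simp only [add_mulVec, ← mulVec_mulVec, hy, mulVec_zero, smul_mulVec, smul_zero, zero_add,
      add_zero] at h1
    have h2 : Bᵀ *ᵥ y = 0 := by
      have h3 := congrArg (y ⬝ᵥ ·) h1
      simp only [dotProduct_mulVec y W, ← mulVec_transpose, hWs, hy, zero_dotProduct,
        dotProduct_smul, dotProduct_mulVec y B] at h3
      simpa using h3.symm
    exact ⟨h2, by rw [h1, h2]; simp⟩
  have hinj : ∀ y, W *ᵥ y = 0 → y = 0 := by
    intro y hy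
    have hk : ∀ k : ℕ, W *ᵥ ((Aᵀ ^ k) *ᵥ y) = 0 := by
      intro k
      induction k with
      | zero => simpa using hy
      | succ k ih => rw [pow_succ', ← mulVec_mulVec]; exact (hker _ ih).2
    exact h y fun k => (hker _ (hk k)).1
  have hdet : IsUnit W.det := by
    rw [isUnit_iff_ne_zero]
    intro h0
    obtain ⟨v, hv, h1⟩ := Matrix.exists_mulVec_eq_zero_iff.2 h0
    exact hv (hinj v h1)
  have hPW : W⁻¹ * W = 1 := nonsing_inv_mul _ hdet
  have hWP : W * W⁻¹ = 1 := mul_nonsing_inv _ hdet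
  have hPp : W⁻¹.PosSemidef := hWp.inv
  have hPs : W⁻¹ᵀ = W⁻¹ := by simpa using hPp.1.eq
  set P := W⁻¹
  have hAP : Aᵀ * P + P * A + (2 * β) • P = (2 : ℝ) • (P * B * Bᵀ * P) := by
    have := congrArg (fun M => P * M * P) hW'
    simp only [Matrix.mul_add, Matrix.add_mul, Matrix.mul_smul, Matrix.smul_mul,
      Matrix.mul_assoc, hWP, Matrix.mul_one] at this
    simp only [← Matrix.mul_assoc, hPW, Matrix.one_mul] at this
    rw [← this, add_comm (Aᵀ * P)]
  have hL : (A - B * (Bᵀ * P))ᵀ * P + P * (A - B * (Bᵀ * P)) = -((2 * β) • P) := by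
    have e : (A - B * (Bᵀ * P))ᵀ * P + P * (A - B * (Bᵀ * P)) =
        Aᵀ * P + P * A - (2 : ℝ) • (P * B * Bᵀ * P) := by
      simp only [transpose_sub, transpose_mul, transpose_transpose, hPs, two_smul,
        Matrix.sub_mul, Matrix.mul_sub, Matrix.mul_assoc]
      abel
    rw [e, ← hAP]
    abel
  refine ⟨Bᵀ * P, isHurwitz_of_real_pair fun a b u v hu hv huv => ?_⟩
  have h1 := dotProduct_lyapunov hPs hu hv
  rw [hL] at h1
  simp only [neg_mulVec, smul_mulVec, dotProduct_neg, dotProduct_smul, smul_eq_mul] at h1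
  have hpos : ∀ w : ι → ℝ, 0 ≤ w ⬝ᵥ P *ᵥ w := fun w => by
    simpa using hPp.dotProduct_mulVec_nonneg w
  have hpos' : ∀ w : ι → ℝ, w ≠ 0 → 0 < w ⬝ᵥ P *ᵥ w := fun w hw => by
    refine lt_of_le_of_ne (hpos w) fun h0 => hw ?_
    have h2 := (hPp.dotProduct_mulVec_zero_iff w).1 (by simpa using h0.symm)
    rw [← one_mulVec w, ← hWP, ← mulVec_mulVec, h2, mulVec_zero]
  have hsum : 0 < u ⬝ᵥ P *ᵥ u + v ⬝ᵥ P *ᵥ v := by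
    rcases huv with h | h
    · linarith [hpos' u h, hpos v]
    · linarith [hpos u, hpos' v h]
  by_contra! ha
  nlinarith [mul_nonneg ha hsum.le, mul_pos hβ hsum]

end Matrix

end RiccatiLQ
-- Extremal solutions of the Riccati equation by Newton-Kleinman iteration.
namespace RiccatiLQ

open Matrix Filter Topology

/-- A decreasing sequence of symmetric matrices that is bounded below converges. -/
theorem exists_tendsto_of_antitone {ι : Type*} [Fintype ι] [DecidableEq ι]
    {X : ℕ → Matrix ι ι ℝ} {L : Matrix ι ι ℝ} (hs : ∀ k, (X k).IsSymm) (hX : Antitone X)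
    (hL : ∀ k, L ≤ X k) : ∃ Y, Tendsto X atTop (𝓝 Y) := by
  have hmono : ∀ {M N : Matrix ι ι ℝ} (x : ι → ℝ), M ≤ N → x ⬝ᵥ M *ᵥ x ≤ x ⬝ᵥ N *ᵥ x := by
    intro M N x h
    have := (Matrix.le_iff.1 h).dotProduct_mulVec_nonneg x
    simpa [sub_mulVec, dotProduct_sub] using this
  have hq : ∀ x : ι → ℝ, ∃ l, Tendsto (fun k => x ⬝ᵥ X k *ᵥ x) atTop (𝓝 l) := fun x =>
    ⟨_, tendsto_atTop_ciInf (fun _ _ h => hmono x (hX h))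
      ⟨x ⬝ᵥ L *ᵥ x, by rintro _ ⟨k, rfl⟩; exact hmono x (hL k)⟩⟩
  choose l hl using hq
  -- Polarization recovers the entries from the limits of the quadratic forms.
  refine ⟨Matrix.of fun i j => (l (Pi.single i 1 + Pi.single j 1) - l (Pi.single i 1) -
    l (Pi.single j 1)) / 2, tendsto_pi_nhds.2 fun i => tendsto_pi_nhds.2 fun j => ?_⟩
  refine ((((hl (Pi.single i 1 + Pi.single j 1)).sub (hl (Pi.single i 1))).sub
    (hl (Pi.single j 1))).div_const 2).congr fun k => ?_
  have hji := (hs k).apply i j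
  simp only [mulVec_add, dotProduct_add, add_dotProduct, single_one_dotProduct, mulVec_single_one,
    Matrix.col_apply]
  rw [hji]
  ring

variable {n m : ℕ} {A Q : Matrix (Fin n) (Fin n) ℝ} {B : Matrix (Fin n) (Fin m) ℝ}

/-- Completing the square in the Riccati map for the feedback `u = -F x`. -/
theorem lyapunov_eq_riccati_add (F : Matrix (Fin m) (Fin n) ℝ) {K : Matrix (Fin n) (Fin n) ℝ}
    (hK : K.IsSymm) :
    (A - B * F)ᵀ * K + K * (A - B * F) =
      riccati A B Q K + (F - Bᵀ * K)ᵀ * (F - Bᵀ * K) - (Q + Fᵀ * F) := by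
  simp only [riccati, transpose_sub, transpose_mul, transpose_transpose, hK.eq,
    Matrix.sub_mul, Matrix.mul_sub, Matrix.mul_assoc]
  abel

theorem posSemidef_transpose_mul_self {ι κ : Type*} [Fintype ι] [Fintype κ] (D : Matrix κ ι ℝ) :
    (Dᵀ * D).PosSemidef := by
  simpa using posSemidef_conjTranspose_mul_self D

/-- One step of the Newton-Kleinman iteration. -/
theorem exists_kleinman_step {L : Matrix (Fin n) (Fin n) ℝ} (hL : L ∈ ariSol A B Q)
    {F : Matrix (Fin m) (Fin n) ℝ} (hF : IsHurwitz (A - B * F)) :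
    ∃ K : Matrix (Fin n) (Fin n) ℝ, K.IsSymm ∧ 0 ≤ -riccati A B Q K ∧
      IsHurwitz (A - B * (Bᵀ * K)) ∧ (∀ L ∈ ariSol A B Q, L ≤ K) ∧
      (A - B * F)ᵀ * K + K * (A - B * F) = -(Q + Fᵀ * F) := by
  obtain ⟨K, hK⟩ := hF.exists_lyapunov (-(Q + Fᵀ * F))
  have hge : ∀ L ∈ ariSol A B Q, (K - L).PosSemidef := by
    rintro L ⟨hLs, hL⟩
    refine hF.posSemidef_of_lyapunov ?_
    have e : -((A - B * F)ᵀ * (K - L) + (K - L) * (A - B * F)) =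
        riccati A B Q L + (F - Bᵀ * L)ᵀ * (F - Bᵀ * L) := by
      have h1 := lyapunov_eq_riccati_add (A := A) (B := B) (Q := Q) F hLs
      rw [Matrix.mul_sub, Matrix.sub_mul K, sub_add_sub_comm, hK, h1]
      abel
    rw [e]
    exact hL.posSemidef.add (posSemidef_transpose_mul_self _)
  have hKs : K.IsSymm := by
    have h1 : (K - L)ᵀ = K - L := by simpa using (hge L hL).1.eq
    rw [transpose_sub, hL.1.eq] at h1
    exact sub_left_injective h1
  have hφ : riccati A B Q K = -((F - Bᵀ * K)ᵀ * (F - Bᵀ * K)) := by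
    have h1 := lyapunov_eq_riccati_add (A := A) (B := B) (Q := Q) F hKs
    rw [hK] at h1
    rw [eq_neg_iff_add_eq_zero]
    rw [eq_sub_iff_add_eq, neg_add_cancel] at h1
    exact h1.symm
  refine ⟨K, hKs, ?_, ?_, fun L hL => hge L hL, hK⟩
  · rw [hφ, neg_neg]; exact (posSemidef_transpose_mul_self _).nonneg
  -- On the kernel of `F - Bᵀ K` the old and new closed loops agree, so modes unseen by `D` are
  -- stable by the choice of `F`.
  refine isHurwitz_of_lyapunov (D := F - Bᵀ * K) (hge L hL) ?_ ?_
  · have e : -((A - B * (Bᵀ * K))ᵀ * (K - L) + (K - L) * (A - B * (Bᵀ * K))) -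
        (F - Bᵀ * K)ᵀ * (F - Bᵀ * K) =
        riccati A B Q L + (Bᵀ * K - Bᵀ * L)ᵀ * (Bᵀ * K - Bᵀ * L) := by
      have h1 := lyapunov_eq_riccati_add (A := A) (B := B) (Q := Q) (Bᵀ * K) hL.1
      have h2 := lyapunov_eq_riccati_add (A := A) (B := B) (Q := Q) (Bᵀ * K) hKs
      rw [Matrix.mul_sub _ K, Matrix.sub_mul K, sub_add_sub_comm, h1, h2, hφ, sub_self,
        Matrix.mul_zero]
      abel
    rw [e]
    exact hL.2.posSemidef.add (posSemidef_transpose_mul_self _)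
  · intro a b u v hu hv huv hDu hDv
    have key : ∀ w, (F - Bᵀ * K) *ᵥ w = 0 → (A - B * F) *ᵥ w = (A - B * (Bᵀ * K)) *ᵥ w := by
      intro w hw
      rw [sub_mulVec, sub_eq_zero] at hw
      rw [sub_mulVec, sub_mulVec, ← mulVec_mulVec, ← mulVec_mulVec, hw]
    exact hF.real_pair ((key u hDu).trans hu) ((key v hDv).trans hv) huv

/-- If `(A, B)` is stabilizable and the Riccati inequality is solvable, then the Riccati equation
has a solution that dominates all solutions of the inequality. -/
theorem exists_greatest_areSol {F : Matrix (Fin m) (Fin n) ℝ} (hF : IsHurwitz (A - B * F))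
    (hne : (ariSol A B Q).Nonempty) : ∃ K ∈ areSol A B Q, ∀ L ∈ ariSol A B Q, L ≤ K := by
  obtain ⟨L, hL⟩ := hne
  let S := {K : Matrix (Fin n) (Fin n) ℝ // K.IsSymm ∧ 0 ≤ -riccati A B Q K ∧
      IsHurwitz (A - B * (Bᵀ * K)) ∧ ∀ L ∈ ariSol A B Q, L ≤ K}
  have hstep : ∀ s : S, ∃ t : S, t.1 ≤ s.1 ∧ (A - B * (Bᵀ * s.1))ᵀ * t.1 +
      t.1 * (A - B * (Bᵀ * s.1)) = -(Q + (Bᵀ * s.1)ᵀ * (Bᵀ * s.1)) := by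
    rintro ⟨K, hKs, hφ, hH, hKL⟩
    obtain ⟨K', h1, h2, h3, h4, h5⟩ := exists_kleinman_step hL hH
    refine ⟨⟨K', h1, h2, h3, h4⟩, ?_, h5⟩
    refine Matrix.le_iff.2 (hH.posSemidef_of_lyapunov ?_)
    have h6 := lyapunov_eq_riccati_add (A := A) (B := B) (Q := Q) (Bᵀ * K) hKs
    have e : -((A - B * (Bᵀ * K))ᵀ * (K - K') + (K - K') * (A - B * (Bᵀ * K))) =
        -riccati A B Q K := by
      rw [Matrix.mul_sub, Matrix.sub_mul K, sub_add_sub_comm, h5, h6, sub_self, Matrix.mul_zero]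
      abel
    rw [e]
    exact hφ.posSemidef
  choose f hf1 hf2 using hstep
  obtain ⟨K₀, h1, h2, h3, h4, -⟩ := exists_kleinman_step hL hF
  let X : ℕ → S := fun k => f^[k] ⟨K₀, h1, h2, h3, h4⟩
  have hXs : ∀ k, X (k + 1) = f (X k) := fun k => Function.iterate_succ_apply' _ _ _
  obtain ⟨Y, hY⟩ := exists_tendsto_of_antitone (X := fun k => (X k).1) (L := L)
    (fun k => (X k).2.1) (antitone_nat_of_succ_le fun k => by rw [hXs]; exact hf1 _)
    (fun k => (X k).2.2.2.2 L hL)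
  have hYs : Y.IsSymm := tendsto_nhds_unique ((Continuous.tendsto (by fun_prop) Y :
      Tendsto (fun M : Matrix (Fin n) (Fin n) ℝ => Mᵀ) (𝓝 Y) (𝓝 Yᵀ)).comp hY)
      (hY.congr fun k => ((X k).2.1).symm)
  have hY' : Tendsto (fun k => (X (k + 1)).1) atTop (𝓝 Y) := hY.comp (tendsto_add_atTop_nat 1)
  -- Consecutive iterates share the limit `Y`, so the Lyapunov recursion becomes `riccati A B Q Y =
  -- 0`.
  have hlim := (Continuous.tendsto (by fun_prop) (Y, Y) :
    Tendsto (fun p : Matrix (Fin n) (Fin n) ℝ × Matrix (Fin n) (Fin n) ℝ =>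
      (A - B * (Bᵀ * p.1))ᵀ * p.2 + p.2 * (A - B * (Bᵀ * p.1)) +
        (Q + (Bᵀ * p.1)ᵀ * (Bᵀ * p.1))) (𝓝 (Y, Y)) _).comp (hY.prodMk_nhds hY')
  have hzero := tendsto_nhds_unique hlim (tendsto_const_nhds.congr fun k => by
    simp only [Function.comp_apply, hXs, hf2]
    exact (neg_add_cancel _).symm)
  refine ⟨Y, ⟨hYs, ?_⟩, fun L' hL' => ?_⟩
  · have h6 := lyapunov_eq_riccati_add (A := A) (B := B) (Q := Q) (Bᵀ * Y) hYs
    rw [h6, sub_self, Matrix.mul_zero] at hzero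
    simpa using hzero
  · exact Matrix.le_iff.2 (posSemidef_of_tendsto
      (fun k => Matrix.le_iff.1 ((X k).2.2.2.2 L' hL')) (hY.sub_const L'))

/-- Time reversal: it exchanges greatest and least solutions. -/
theorem riccati_neg (A Q K : Matrix (Fin n) (Fin n) ℝ) (B : Matrix (Fin n) (Fin m) ℝ) :
    riccati (-A) B Q (-K) = riccati A B Q K := by
  simp [riccati]

/-- If `(A, B)` is controllable and the Riccati inequality is solvable, then the Riccati equation
has a solution that is dominated by all solutions of the inequality. -/
theorem exists_least_areSol
    (hc : ∀ y : Fin n → ℝ, (∀ k : ℕ, Bᵀ *ᵥ ((Aᵀ ^ k) *ᵥ y) = 0) → y = 0)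
    (hne : (ariSol A B Q).Nonempty) : ∃ K ∈ areSol A B Q, ∀ L ∈ ariSol A B Q, K ≤ L := by
  have hneg : ∀ L ∈ ariSol A B Q, -L ∈ ariSol (-A) B Q := fun L hL =>
    ⟨by simpa [IsSymm] using hL.1.eq, by rw [riccati_neg]; exact hL.2⟩
  -- Controllability, unlike stabilizability, survives the sign change of `A`.
  obtain ⟨F, hF⟩ := exists_isHurwitz_of_controllable (A := -A) (B := B) fun y hy =>
    hc y fun k => by
      have h1 := hy k
      rw [transpose_neg, neg_pow, ← mulVec_mulVec] at h1
      rcases neg_one_pow_eq_or (Matrix (Fin n) (Fin n) ℝ) k with h | h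
      · simpa [h] using h1
      · simpa [h, neg_mulVec, mulVec_neg] using h1
  obtain ⟨L₀, hL₀⟩ := hne
  obtain ⟨K, hK, hmax⟩ := exists_greatest_areSol hF ⟨-L₀, hneg L₀ hL₀⟩
  refine ⟨-K, ⟨by simpa [IsSymm] using hK.1.eq, ?_⟩, fun L hL => neg_le.1 (hmax _ (hneg L hL))⟩
  rw [← riccati_neg, neg_neg]
  exact hK.2

end RiccatiLQ
-- Reduction to the controllable subspace.
namespace RiccatiLQ

open Matrix

variable {n m n₁ n₂ : ℕ}

theorem pow_mulVec_mem_controllableSubspace (A : Matrix (Fin n) (Fin n) ℝ)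
    (B : Matrix (Fin n) (Fin m) ℝ) (k : ℕ) (u : Fin m → ℝ) :
    (A ^ k) *ᵥ (B *ᵥ u) ∈ controllableSubspace A B := by
  have hlt : ∀ j < n, (A ^ j) *ᵥ (B *ᵥ u) ∈ controllableSubspace A B := fun j hj =>
    Submodule.mem_iSup_of_mem (⟨j, hj⟩ : Fin n) ⟨B *ᵥ u, ⟨u, rfl⟩, rfl⟩
  rcases Nat.eq_zero_or_pos n with rfl | hn
  · rw [Subsingleton.elim ((A ^ k) *ᵥ (B *ᵥ u)) 0]
    exact Submodule.zero_mem _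
  -- Cayley-Hamilton: every power of `A` is a combination of those below `n`.
  rw [Matrix.pow_eq_aeval_mod_charpoly, Polynomial.aeval_eq_sum_range' (n := n), sum_mulVec]
  · refine Submodule.sum_mem _ fun j hj => ?_
    rw [smul_mulVec]
    exact Submodule.smul_mem _ _ (hlt j (Finset.mem_range.1 hj))
  · have h := Polynomial.natDegree_modByMonic_lt (Polynomial.X ^ k : Polynomial ℝ)
      A.charpoly_monic (fun h => by
        have := A.charpoly_natDegree_eq_dim
        rw [h] at this
        simp at this
        omega)
    simpa [A.charpoly_natDegree_eq_dim] using h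

theorem controllableSubspace_le {A : Matrix (Fin n) (Fin n) ℝ}
    {B : Matrix (Fin n) (Fin m) ℝ} {p : Submodule ℝ (Fin n → ℝ)}
    (h : ∀ k u, (A ^ k) *ᵥ (B *ᵥ u) ∈ p) : controllableSubspace A B ≤ p := by
  refine iSup_le fun k => ?_
  rintro _ ⟨_, ⟨u, rfl⟩, rfl⟩
  exact h k u

theorem mulVec_mem_controllableSubspace {A : Matrix (Fin n) (Fin n) ℝ}
    {B : Matrix (Fin n) (Fin m) ℝ} {x : Fin n → ℝ} (hx : x ∈ controllableSubspace A B) :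
    A *ᵥ x ∈ controllableSubspace A B := by
  have : controllableSubspace A B ≤ (controllableSubspace A B).comap A.mulVecLin :=
    controllableSubspace_le fun k u => by
      have := pow_mulVec_mem_controllableSubspace A B (k + 1) u
      rw [pow_succ', ← mulVec_mulVec] at this
      exact this
  exact this hx

/-- The first `n₁` columns of `basisMatrix b`. -/
noncomputable def basisCols (b : Module.Basis (Fin n₁ ⊕ Fin n₂) ℝ (Fin n → ℝ)) :
    Matrix (Fin n) (Fin n₁) ℝ :=
  (basisMatrix b).toCols₁

/-- The first `n₁` rows of `basisMatrixInv b`. -/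
noncomputable def basisInvRows (b : Module.Basis (Fin n₁ ⊕ Fin n₂) ℝ (Fin n → ℝ)) :
    Matrix (Fin n₁) (Fin n) ℝ :=
  (basisMatrixInv b).toRows₁

variable (b : Module.Basis (Fin n₁ ⊕ Fin n₂) ℝ (Fin n → ℝ))

theorem blockA_eq (A : Matrix (Fin n) (Fin n) ℝ) :
    blockA b A = basisInvRows b * A * basisCols b := by
  ext i j
  rfl

theorem blockB_eq (B : Matrix (Fin n) (Fin m) ℝ) : blockB b B = basisInvRows b * B := by
  ext i j
  rfl

theorem blockQ_eq (Q : Matrix (Fin n) (Fin n) ℝ) :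
    blockQ b Q = (basisCols b)ᵀ * Q * basisCols b := by
  ext i j
  rfl

theorem basisInvRows_mul_basisCols : basisInvRows b * basisCols b = 1 := by
  have h : basisInvRows b * basisCols b = (basisMatrixInv b * basisMatrix b).toBlocks₁₁ := by
    ext i j
    rfl
  rw [h, basisMatrixInv_mul]
  ext i j
  simp [toBlocks₁₁, one_apply]

theorem basisCols_mulVec_single (i : Fin n₁) : basisCols b *ᵥ Pi.single i 1 = b (Sum.inl i) := by
  ext j
  simp [basisCols, basisMatrix, toCols₁, Module.Basis.toMatrix_apply]

variable {b} {A : Matrix (Fin n) (Fin n) ℝ} {B : Matrix (Fin n) (Fin m) ℝ}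
  (hb : Submodule.span ℝ (Set.range fun i : Fin n₁ => b (Sum.inl i)) = controllableSubspace A B)
include hb

theorem basisCols_mulVec_basisInvRows_mulVec {x : Fin n → ℝ} (hx : x ∈ controllableSubspace A B) :
    basisCols b *ᵥ (basisInvRows b *ᵥ x) = x := by
  rw [← hb] at hx
  induction hx using Submodule.span_induction with
  | mem x h =>
    obtain ⟨i, rfl⟩ := h
    simp only [← basisCols_mulVec_single b, mulVec_mulVec]
    rw [← Matrix.mul_assoc, Matrix.mul_assoc, basisInvRows_mul_basisCols, Matrix.mul_one]
  | zero => simp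
  | add x y _ _ h1 h2 => rw [mulVec_add, mulVec_add, h1, h2]
  | smul c x _ h => rw [mulVec_smul, mulVec_smul, h]

theorem basisCols_mul_blockB : basisCols b * blockB b B = B := by
  refine Matrix.ext_of_mulVec_single fun j => ?_
  rw [blockB_eq, ← mulVec_mulVec, ← mulVec_mulVec]
  refine basisCols_mulVec_basisInvRows_mulVec hb ?_
  simpa using pow_mulVec_mem_controllableSubspace A B 0 (Pi.single j 1)

theorem basisCols_mul_blockA : basisCols b * blockA b A = A * basisCols b := by
  refine Matrix.ext_of_mulVec_single fun j => ?_
  rw [blockA_eq, Matrix.mul_assoc, ← mulVec_mulVec, ← mulVec_mulVec]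
  refine basisCols_mulVec_basisInvRows_mulVec hb ?_
  rw [← mulVec_mulVec, basisCols_mulVec_single]
  exact mulVec_mem_controllableSubspace (hb ▸ Submodule.subset_span ⟨j, rfl⟩)

theorem basisCols_mul_blockA_pow (k : ℕ) : basisCols b * blockA b A ^ k = A ^ k * basisCols b := by
  induction k with
  | zero => simp
  | succ k ih =>
    rw [pow_succ, ← Matrix.mul_assoc, ih, Matrix.mul_assoc, basisCols_mul_blockA hb,
      ← Matrix.mul_assoc, pow_succ]

theorem block_controllable (y : Fin n₁ → ℝ)
    (hy : ∀ k : ℕ, (blockB b B)ᵀ *ᵥ (((blockA b A)ᵀ ^ k) *ᵥ y) = 0) : y = 0 := by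
  -- Pairing `y` with the first `n₁` coordinates kills every `A ^ k B u`, hence the whole
  -- controllable subspace; its basis vectors then read off `y i = 0`.
  let ℓ : (Fin n → ℝ) →ₗ[ℝ] ℝ := (dotProductBilin ℝ ℝ y).comp (basisInvRows b).mulVecLin
  have hℓ : ∀ x, ℓ x = y ⬝ᵥ basisInvRows b *ᵥ x := fun x => rfl
  have h : controllableSubspace A B ≤ LinearMap.ker ℓ := by
    refine controllableSubspace_le fun k u => ?_
    have e : basisInvRows b * (A ^ k * B) = blockA b A ^ k * blockB b B := by
      nth_rw 1 [← basisCols_mul_blockB hb]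
      rw [← Matrix.mul_assoc (A ^ k), ← basisCols_mul_blockA_pow hb, Matrix.mul_assoc (basisCols b),
        ← Matrix.mul_assoc, basisInvRows_mul_basisCols, Matrix.one_mul]
    rw [LinearMap.mem_ker, hℓ, mulVec_mulVec, mulVec_mulVec, Matrix.mul_assoc, e,
      dotProduct_mulVec, dotProduct_comm, ← mulVec_transpose,
      transpose_mul, transpose_pow, ← mulVec_mulVec, hy, dotProduct_zero]
  ext i
  have h1 : b (Sum.inl i) ∈ controllableSubspace A B := hb ▸ Submodule.subset_span ⟨i, rfl⟩
  have h2 := h h1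
  rw [LinearMap.mem_ker, hℓ, ← basisCols_mulVec_single, mulVec_mulVec, basisInvRows_mul_basisCols,
    one_mulVec] at h2
  simpa using h2

theorem riccati_block (Q K : Matrix (Fin n) (Fin n) ℝ) :
    riccati (blockA b A) (blockB b B) (blockQ b Q) (blockQ b K) =
      (basisCols b)ᵀ * riccati A B Q K * basisCols b := by
  have hA := basisCols_mul_blockA hb
  have hB := basisCols_mul_blockB hb
  have hA' : (blockA b A)ᵀ * (basisCols b)ᵀ = (basisCols b)ᵀ * Aᵀ := by
    rw [← transpose_mul, ← transpose_mul, hA]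
  have hB' : (blockB b B)ᵀ * (basisCols b)ᵀ = Bᵀ := by rw [← transpose_mul, hB]
  have e1 : (blockA b A)ᵀ * blockQ b K = (basisCols b)ᵀ * (Aᵀ * K) * basisCols b := by
    rw [blockQ_eq, ← Matrix.mul_assoc, ← Matrix.mul_assoc, hA']
    simp only [Matrix.mul_assoc]
  have e2 : blockQ b K * blockA b A = (basisCols b)ᵀ * (K * A) * basisCols b := by
    rw [blockQ_eq, Matrix.mul_assoc, hA]
    simp only [Matrix.mul_assoc]
  have e3 : blockQ b K * blockB b B = (basisCols b)ᵀ * (K * B) := by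
    rw [blockQ_eq, Matrix.mul_assoc, hB, Matrix.mul_assoc]
  have e4 : (blockB b B)ᵀ * blockQ b K = Bᵀ * K * basisCols b := by
    rw [blockQ_eq, ← Matrix.mul_assoc, ← Matrix.mul_assoc, hB']
  rw [riccati, riccati, e1, e2, e3, Matrix.mul_assoc _ (blockB b B)ᵀ, e4, blockQ_eq]
  simp only [Matrix.mul_add, Matrix.add_mul, Matrix.mul_sub, Matrix.sub_mul, Matrix.mul_assoc]

omit hb in
theorem blockQ_mono {K L : Matrix (Fin n) (Fin n) ℝ} (h : K ≤ L) : blockQ b K ≤ blockQ b L := by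
  rw [Matrix.le_iff] at h ⊢
  have := h.conjTranspose_mul_mul_same (basisCols b)
  rwa [conjTranspose_eq_transpose_of_trivial, Matrix.mul_sub, Matrix.sub_mul, ← blockQ_eq,
    ← blockQ_eq] at this

end RiccatiLQ

/-- `b` is a basis of the state space adapted to the decomposition `ℝⁿ = 𝒞 ⊕ X₂`, where `𝒞` is the
controllable subspace and `X₂` an arbitrary complement. -/
theorem lemma3p5 {n m n₁ n₂ : ℕ}
    (A : Matrix (Fin n) (Fin n) ℝ) (B : Matrix (Fin n) (Fin m) ℝ) (Q : Matrix (Fin n) (Fin n) ℝ)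
    (hQ : Q.IsSymm)
    (hstab : RiccatiLQ.Stabilizable A B)
    (hne : (RiccatiLQ.ariSolNeg A B Q).Nonempty)
    (X₂ : Submodule ℝ (Fin n → ℝ))
    (hX₂ : IsCompl (RiccatiLQ.controllableSubspace A B) X₂)
    (b : Module.Basis (Fin n₁ ⊕ Fin n₂) ℝ (Fin n → ℝ))
    (hb₁ : Submodule.span ℝ (Set.range fun i : Fin n₁ => b (Sum.inl i)) =
      RiccatiLQ.controllableSubspace A B)
    (hb₂ : Submodule.span ℝ (Set.range fun j : Fin n₂ => b (Sum.inr j)) = X₂) :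
    ∃ K₁m ∈ RiccatiLQ.areSolNeg (RiccatiLQ.blockA b A) (RiccatiLQ.blockB b B)
        (RiccatiLQ.blockQ b Q),
      IsLeast (RiccatiLQ.areSol (RiccatiLQ.blockA b A) (RiccatiLQ.blockB b B)
        (RiccatiLQ.blockQ b Q)) K₁m := by
  obtain ⟨K, ⟨hKs, hK⟩, hK0⟩ := hne
  have hz : RiccatiLQ.blockQ b (0 : Matrix (Fin n) (Fin n) ℝ) = 0 := by
    simp [RiccatiLQ.blockQ_eq]
  have hmem : RiccatiLQ.blockQ b K ∈ RiccatiLQ.ariSol (RiccatiLQ.blockA b A)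
      (RiccatiLQ.blockB b B) (RiccatiLQ.blockQ b Q) := by
    refine ⟨?_, ?_⟩
    · rw [Matrix.IsSymm, RiccatiLQ.blockQ_eq]
      simp only [Matrix.transpose_mul, Matrix.transpose_transpose, hKs.eq, Matrix.mul_assoc]
    · rw [RiccatiLQ.riccati_block hb₁, ← RiccatiLQ.blockQ_eq, ← hz]
      exact RiccatiLQ.blockQ_mono hK
  obtain ⟨K₁, hK₁, hmin⟩ := RiccatiLQ.exists_least_areSol
    (RiccatiLQ.block_controllable hb₁) ⟨_, hmem⟩
  -- Negativity: `K₁` lies below the compression of `K`, which is `≤ 0`.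
  refine ⟨K₁, ⟨hK₁, (hmin _ hmem).trans (hz ▸ RiccatiLQ.blockQ_mono hK0)⟩, hK₁, fun L hL => ?_⟩
  exact hmin L ⟨hL.1, hL.2.ge⟩
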